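/- Let $(\tilde M^{n+1},\tilde g,\tilde\nabla,J)$ be a locally metallic Riemannian manifold: $\tilde g$ is a Riemannian metric with Levi-Civita connection $\tilde\nabla$, and $J$ is a smooth $(1,1)$-tensor field with $J^2=pJ+qI$ for positive integers $p,q$, $\tilde g(JX,Y)=\tilde g(X,JY)$ and $\tilde\nabla J=0$. Let $M^n$ be an (immersed) hypersurface of $\tilde M$ with a global smooth unit normal vector field $\nu$, induced metric $g$, Levi-Civita connection $\nabla$ of $g$, and shape operator $A$ given by $\tilde\nabla_X\nu=-AX$. Suppose that $M$ is a quadratic metric $\varphi$-hypersurface, that is, there are on $M$ a smooth $(1,1)$-tensor field $\varphi$, a smooth vector field $\xi$ and a smooth $1$-form $\eta$ such that, for all $X$ tangent to $M$, $$JX=\varphi X+\eta(X)\nu,\qquad J\nu=q\xi+p\nu,\qquad J\xi=\nu,$$ and $(\varphi,\eta,\xi)$ is an almost quadratic metric $\varphi$-structure on $(M,g)$: $g(\xi,\xi)=1$, $\varphi\xi=0$, $\varphi^2=p\varphi+q(I-\eta\otimes\xi)$ and $g(\varphi X,Y)=g(X,\varphi Y)$. Suppose moreover that this structure is $(\beta,\varphi)$-Kenmotsu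 for some $\beta\in C^\infty(M)$: $$(\nabla_X\varphi)Y=\beta\,\{g(X,\varphi Y)\,\xi+\eta(Y)\,\varphi X\}\qquad\text{for all vector fields }X,Y\text{ on }M.$$ Then $\varphi A=A\varphi$, $A=\beta\varphi$, and $A^2=\beta pA+\beta^2(I-\eta\otimes\xi)$. -/

import Mathlib

open Bundle
open scoped Manifold ContDiff

noncomputable section MetallicGeometry

section OneManifold

variable {E : Type*} [NormedAddCommGroup E] [NormedSpace ℝ E] [FiniteDimensional ℝ E]
  {H : Type*} [TopologicalSpace H] {I : ModelWithCorners ℝ E H}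
  {M : Type*} [TopologicalSpace M] [ChartedSpace H M] [IsManifold I ∞ M]

/-- A smooth `(1,1)`-tensor field `K` on `M`. -/
def IsSmoothEndo (K : ∀ x : M, TangentSpace I x →L[ℝ] TangentSpace I x) : Prop :=
  ContMDiff I (I.prod 𝓘(ℝ, E →L[ℝ] E)) ∞
    (fun x ↦ TotalSpace.mk' (E →L[ℝ] E)
      (E := fun x : M ↦ TangentSpace I x →L[ℝ] TangentSpace I x) x (K x))

/-- A smooth `1`-form `η` on `M`. -/
def IsSmoothOneForm (η : ∀ x : M, TangentSpace I x →L[ℝ] ℝ) : Prop :=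
  ContMDiff I (I.prod 𝓘(ℝ, E →L[ℝ] ℝ)) ∞
    (fun x ↦ TotalSpace.mk' (E →L[ℝ] ℝ)
      (E := fun x : M ↦ TangentSpace I x →L[ℝ] (Bundle.Trivial M ℝ) x) x (η x))

/-- A smooth vector field `ξ` on `M`. -/
def IsSmoothVectorField (ξ : ∀ x : M, TangentSpace I x) : Prop :=
  ContMDiff I I.tangent ∞ (fun x ↦ (⟨x, ξ x⟩ : TangentBundle I M))

/-- The covariant derivative of a `(1,1)`-tensor field `K`, applied to a vector field `Y`:
`(∇_v K) Y = ∇_v (K Y) - K (∇_v Y)` for `v` tangent to `M` at `x`.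
(In Mathlib's argument order `cov Y x v` is `∇_v Y` at `x`.) -/
def covDerivEndo (cov : CovariantDerivative I E (TangentSpace I : M → Type _))
    (K : ∀ x : M, TangentSpace I x →L[ℝ] TangentSpace I x)
    (Y : ∀ x : M, TangentSpace I x) (x : M) (v : TangentSpace I x) : TangentSpace I x :=
  cov (fun y ↦ K y (Y y)) x v - K x (cov Y x v)

variable [RiemannianBundle (fun x : M ↦ TangentSpace I x)]

/-- `cov` is the Levi-Civita connection of the Riemannian metric of `M`: it is compatible with the
metric, `v (g(Y, Z)) = g(∇_v Y, Z) + g(Y, ∇_v Z)`, and torsion-free. -/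
structure IsLeviCivita
    (cov : CovariantDerivative I E (TangentSpace I : M → Type _)) : Prop where
  metric : ∀ (x : M) (Y Z : ∀ y : M, TangentSpace I y), MDiffAt (T% Y) x → MDiffAt (T% Z) x →
    ∀ v : TangentSpace I x,
      mvfderiv I (fun y ↦ (inner ℝ (Y y) (Z y) : ℝ)) x v =
        inner ℝ (cov Y x v) (Z x) + inner ℝ (Y x) (cov Z x v)
  torsion_free : cov.torsion = 0

/-- `J` is a metallic Riemannian structure with coefficients `p`, `q` (positive integers):
`J² = p J + q I`, and the metric is compatible with `J`. -/
structure IsMetallicRiemannian (p q : ℕ)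
    (J : ∀ x : M, TangentSpace I x →L[ℝ] TangentSpace I x) : Prop where
  p_pos : 0 < p
  q_pos : 0 < q
  smooth : IsSmoothEndo J
  sq : ∀ (x : M) (v : TangentSpace I x), J x (J x v) = (p : ℝ) • J x v + (q : ℝ) • v
  compatible : ∀ (x : M) (v w : TangentSpace I x), inner ℝ (J x v) w = inner ℝ v (J x w)

/-- A metallic Riemannian structure `J` is locally metallic if `∇J = 0`, where `cov` is the
Levi-Civita connection. -/
structure IsLocallyMetallic
    (cov : CovariantDerivative I E (TangentSpace I : M → Type _)) (p q : ℕ)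
    (J : ∀ x : M, TangentSpace I x →L[ℝ] TangentSpace I x) : Prop
    extends IsMetallicRiemannian p q J where
  leviCivita : IsLeviCivita cov
  parallel : ∀ (x : M) (Y : ∀ y : M, TangentSpace I y), MDiffAt (T% Y) x →
    ∀ v : TangentSpace I x, covDerivEndo cov J Y x v = 0

/-- `(φ, η, ξ)` is an almost quadratic metric `φ`-structure with coefficients `a`, `b`:
`ξ` is a unit vector field, `φ ξ = 0`, `φ² = a φ + b (I - η ⊗ ξ)` with `b ≠ 0` and
`a² + 4 b ≠ 0`, and the metric is compatible with `φ`. -/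
structure IsAlmostQuadraticMetric (a b : ℝ)
    (φ : ∀ x : M, TangentSpace I x →L[ℝ] TangentSpace I x)
    (ξ : ∀ x : M, TangentSpace I x) (η : ∀ x : M, TangentSpace I x →L[ℝ] ℝ) : Prop where
  b_ne_zero : b ≠ 0
  discr_ne_zero : a ^ 2 + 4 * b ≠ 0
  smooth_endo : IsSmoothEndo φ
  smooth_field : IsSmoothVectorField ξ
  smooth_form : IsSmoothOneForm η
  unit : ∀ x : M, inner ℝ (ξ x) (ξ x) = (1 : ℝ)
  apply_field : ∀ x : M, φ x (ξ x) = 0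
  sq : ∀ (x : M) (v : TangentSpace I x),
    φ x (φ x v) = a • φ x v + b • (v - η x v • ξ x)
  compatible : ∀ (x : M) (v w : TangentSpace I x), inner ℝ (φ x v) w = inner ℝ v (φ x w)

/-- The `(β, φ)`-Kenmotsu condition
`(∇_X φ) Y = β (g(X, φ Y) ξ + η(Y) φ X)`, with `β` a smooth function and `∇` the Levi-Civita
connection. -/
structure IsKenmotsu
    (cov : CovariantDerivative I E (TangentSpace I : M → Type _)) (β : M → ℝ)
    (φ : ∀ x : M, TangentSpace I x →L[ℝ] TangentSpace I x)
    (ξ : ∀ x : M, TangentSpace I x) (η : ∀ x : M, TangentSpace I x →L[ℝ] ℝ) : Prop where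
  leviCivita : IsLeviCivita cov
  smooth : ContMDiff I 𝓘(ℝ, ℝ) ∞ β
  deriv_endo : ∀ (x : M) (Y : ∀ y : M, TangentSpace I y), MDiffAt (T% Y) x →
    ∀ v : TangentSpace I x, covDerivEndo cov φ Y x v =
      β x • ((inner ℝ v (φ x (Y x)) : ℝ) • ξ x + η x (Y x) • φ x v)

end OneManifold

section Hypersurface

variable {E : Type*} [NormedAddCommGroup E] [NormedSpace ℝ E] [FiniteDimensional ℝ E]
  {H : Type*} [TopologicalSpace H] {I : ModelWithCorners ℝ E H}
  {M : Type*} [TopologicalSpace M] [ChartedSpace H M] [IsManifold I ∞ M]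
  {E' : Type*} [NormedAddCommGroup E'] [NormedSpace ℝ E'] [FiniteDimensional ℝ E']
  {H' : Type*} [TopologicalSpace H'] {I' : ModelWithCorners ℝ E' H'}
  {M' : Type*} [TopologicalSpace M'] [ChartedSpace H' M'] [IsManifold I' ∞ M']

/-- The covariant derivative `∇'_v N` of a vector field `N` along a map `f : M → M'`
(the connection induced by `cov` on the pullback of `TM'`). Let `e₁, …, eₘ` be the coordinate frame
of `TM'` around `f x` and write `N = ∑ Nⁱ (eᵢ ∘ f)` near `x`. Then
`∇'_v N = ∑ dNⁱ(v) eᵢ + ∇'_{df v} (∑ Nⁱ(x) eᵢ)`; the frame is that of the preferred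
trivialization at `f x`, and `FiberBundle.extend E' (N x)` is the field `∑ Nⁱ(x) eᵢ`, which has
constant components and the value `N x` at `f x`. -/
def covDerivAlong (cov : CovariantDerivative I' E' (TangentSpace I' : M' → Type _))
    (f : M → M') (N : ∀ x : M, TangentSpace I' (f x)) (x : M) (v : TangentSpace I x) :
    TangentSpace I' (f x) :=
  (trivializationAt E' (TangentSpace I' : M' → Type _) (f x)).symm (f x)
      (mfderiv I 𝓘(ℝ, E')
        (fun y ↦ (trivializationAt E' (TangentSpace I' : M' → Type _) (f x) ⟨f y, N y⟩).2) x v)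
    + cov (FiberBundle.extend E' (N x)) (f x) (mfderiv I I' f x v)

variable [RiemannianBundle (fun x : M ↦ TangentSpace I x)]
  [RiemannianBundle (fun x : M' ↦ TangentSpace I' x)]

/-- `f : M → M'` is an isometric immersion with smooth unit normal field `ν`; the metric of `M` is
the one induced from `M'` (so the differential of `f` is injective). -/
structure IsIsometricImmersionWithNormal (f : M → M') (ν : ∀ x : M, TangentSpace I' (f x)) :
    Prop where
  smooth : ContMDiff I I' ∞ f
  isometric : ∀ (x : M) (v w : TangentSpace I x),
    inner ℝ (mfderiv I I' f x v) (mfderiv I I' f x w) = (inner ℝ v w : ℝ)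
  smooth_normal : ContMDiff I I'.tangent ∞ (fun x ↦ (⟨f x, ν x⟩ : TangentBundle I' M'))
  unit : ∀ x : M, inner ℝ (ν x) (ν x) = (1 : ℝ)
  normal : ∀ (x : M) (v : TangentSpace I x), inner ℝ (mfderiv I I' f x v) (ν x) = (0 : ℝ)

/-- The shape operator `A` of the hypersurface `f : M → M'` with respect to the unit normal `ν`,
defined by the Weingarten formula `df (A v) = -∇'_v ν`. (The adjoint of the isometry `df` is the
orthogonal projection onto the tangent space of `M`, so that `A v` is the tangential part of
`-∇'_v ν`; its normal part vanishes as `ν` has length one.) -/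
def shapeOperator (cov : CovariantDerivative I' E' (TangentSpace I' : M' → Type _))
    (f : M → M') (ν : ∀ x : M, TangentSpace I' (f x)) (x : M) (v : TangentSpace I x) :
    TangentSpace I x :=
  haveI : FiniteDimensional ℝ (TangentSpace I x) := inferInstanceAs (FiniteDimensional ℝ E)
  haveI : FiniteDimensional ℝ (TangentSpace I' (f x)) := inferInstanceAs (FiniteDimensional ℝ E')
  LinearMap.adjoint (mfderiv I I' f x).toLinearMap (-covDerivAlong cov f ν x v)

/-- `M` with `(φ, η, ξ)` is a quadratic metric `φ`-hypersurface of the metallic Riemannian manifold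
`(M', J)`: `(φ, η, ξ)` is the structure induced by `J` through
`J X = φ X + η(X) ν`, `J ν = q ξ + p ν`, `J ξ = ν`, and it is an almost quadratic metric
`φ`-structure for the induced metric. -/
structure IsQuadraticMetricHypersurface (p q : ℕ)
    (J : ∀ y : M', TangentSpace I' y →L[ℝ] TangentSpace I' y)
    (f : M → M') (ν : ∀ x : M, TangentSpace I' (f x))
    (φ : ∀ x : M, TangentSpace I x →L[ℝ] TangentSpace I x)
    (ξ : ∀ x : M, TangentSpace I x) (η : ∀ x : M, TangentSpace I x →L[ℝ] ℝ) : Prop where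
  immersion : IsIsometricImmersionWithNormal (I := I) (I' := I') f ν
  map_tangent : ∀ (x : M) (v : TangentSpace I x),
    J (f x) (mfderiv I I' f x v) = mfderiv I I' f x (φ x v) + η x v • ν x
  map_normal : ∀ x : M,
    J (f x) (ν x) = (q : ℝ) • mfderiv I I' f x (ξ x) + (p : ℝ) • ν x
  map_field : ∀ x : M, J (f x) (mfderiv I I' f x (ξ x)) = ν x
  almostQuadratic : IsAlmostQuadraticMetric (p : ℝ) (q : ℝ) φ ξ η

end Hypersurface

end MetallicGeometry

open scoped Topology

/-! Write D for the connection along `f`, and W = D_v(df ξ). Since ν = J(df ξ) and J is parallel,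
D_v ν = J W. Pairing with df z and moving J across, g(D_v ν, df z) = g(W, df(φ z)) + η(z) g(W, ν).
By the Gauss formula the first term is g(∇_v ξ, φ z) = g(φ ∇_v ξ, z), and the Kenmotsu condition at
Y = ξ, where φ ξ = 0 and η(ξ) = 1, says φ ∇_v ξ = -β φ v. At z = ξ this leaves g(D_v ν, df ξ) = g(W,
ν), whereas differentiating g(df ξ, ν) = 0 shows that these two numbers are opposite; so both vanish
and A = β φ (`IsKenmotsu.shapeOperator_eq`). The other two identities are algebra, with q = 1 forced
by `IsQuadraticMetricHypersurface.coeff_eq_one`.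

The bulk of the work is to show that D, defined by a formula in one trivialization, is a genuine
pullback connection: it obeys the Leibniz and chain rules, commutes with parallel endomorphisms
(`covDerivAlong_endo`), is metric (`mvfderiv_inner_along`) and torsion-free
(`covDerivAlong_pushforward_extend_comm`). The Gauss formula `inner_covDerivAlong_pushforward` then
follows as in the uniqueness proof for the Levi-Civita connection. -/

lemma Filter.EventuallyEq.mvfderiv_eq {E : Type*} [NormedAddCommGroup E] [NormedSpace ℝ E]
    {H : Type*} [TopologicalSpace H] {I : ModelWithCorners ℝ E H}
    {M : Type*} [TopologicalSpace M] [ChartedSpace H M]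
    {F : Type*} [NormedAddCommGroup F] [NormedSpace ℝ F] {g g' : M → F} {x : M}
    (h : g =ᶠ[𝓝 x] g') : mvfderiv I g x = mvfderiv I g' x := by
  rw [mvfderiv, mvfderiv, h.mfderiv_eq, h.self_of_nhds]

/-! ### Fields along a map and the calculus of the pullback connection. -/

section AlongMaps

variable {E : Type*} [NormedAddCommGroup E] [NormedSpace ℝ E]
  {H : Type*} [TopologicalSpace H] {I : ModelWithCorners ℝ E H}
  {M : Type*} [TopologicalSpace M] [ChartedSpace H M]
  {E' : Type*} [NormedAddCommGroup E'] [NormedSpace ℝ E']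
  {H' : Type*} [TopologicalSpace H'] {I' : ModelWithCorners ℝ E' H'}
  {M' : Type*} [TopologicalSpace M'] [ChartedSpace H' M'] [IsManifold I' ∞ M']

/-- The field `N` along `f` is differentiable at `x`. -/
def MDiffAlongAt (I : ModelWithCorners ℝ E H) (f : M → M') (N : ∀ x : M, TangentSpace I' (f x))
    (x : M) : Prop :=
  MDifferentiableAt I I'.tangent (fun y ↦ (⟨f y, N y⟩ : TangentBundle I' M')) x

/-- The components near `x` of a field `N` along `f` in the preferred trivialization at `f x`. -/
noncomputable def alongComp (f : M → M') (N : ∀ x : M, TangentSpace I' (f x)) (x y : M) : E' :=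
  (trivializationAt E' (TangentSpace I' : M' → Type _) (f x)).continuousLinearMapAt ℝ (f y) (N y)

omit [IsManifold I' ∞ M'] in
lemma eventually_mem_baseSet {f : M → M'} {x : M} (hf : ContinuousAt f x) [IsManifold I' 1 M'] :
    ∀ᶠ y in 𝓝 x, f y ∈ (trivializationAt E' (TangentSpace I' : M' → Type _) (f x)).baseSet :=
  hf.eventually_mem ((trivializationAt E' (TangentSpace I' : M' → Type _) (f x)).open_baseSet.mem_nhds
    (FiberBundle.mem_baseSet_trivializationAt' _))

/-- `alongComp` is linear in the field even off the base set, so sums and multiples can be handled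
as equalities of functions; derivatives at `x` see only the germ, where both expressions agree. -/
lemma eventually_trivialization_eq_alongComp {f : M → M'} {x : M} (hf : ContinuousAt f x)
    (N : ∀ x : M, TangentSpace I' (f x)) :
    (fun y ↦ (trivializationAt E' (TangentSpace I' : M' → Type _) (f x) ⟨f y, N y⟩).2)
      =ᶠ[𝓝 x] alongComp f N x := by
  filter_upwards [eventually_mem_baseSet (I' := I') hf] with y hy
  exact (Trivialization.continuousLinearMapAt_apply_of_mem ℝ _ hy _).symm

lemma mdiffAlongAt_iff {f : M → M'} {x : M} {N : ∀ x : M, TangentSpace I' (f x)} :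
    MDiffAlongAt I f N x ↔
      MDifferentiableAt I I' f x ∧ MDifferentiableAt I 𝓘(ℝ, E') (alongComp f N x) x := by
  unfold MDiffAlongAt
  rw [mdifferentiableAt_totalSpace]
  refine and_congr_right fun h ↦ ?_
  exact (eventually_trivialization_eq_alongComp h.continuousAt N).mdifferentiableAt_iff

lemma covDerivAlong_eq (cov : CovariantDerivative I' E' (TangentSpace I' : M' → Type _))
    {f : M → M'} {x : M} (hf : ContinuousAt f x) [FiniteDimensional ℝ E']
    (N : ∀ x : M, TangentSpace I' (f x)) (v : TangentSpace I x) :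
    covDerivAlong cov f N x v =
      (trivializationAt E' (TangentSpace I' : M' → Type _) (f x)).symmL ℝ (f x)
        (mvfderiv I (alongComp f N x) x v)
      + cov (FiberBundle.extend E' (N x)) (f x) (mfderiv I I' f x v) := by
  unfold covDerivAlong
  rw [(eventually_trivialization_eq_alongComp (I' := I') hf N).mfderiv_eq,
    Trivialization.symmL_apply _ (FiberBundle.mem_baseSet_trivializationAt' _)]
  rfl

section extend

variable [FiniteDimensional ℝ E'] (cov : CovariantDerivative I' E' (TangentSpace I' : M' → Type _))

omit [FiniteDimensional ℝ E'] in
lemma CovariantDerivative.congr_germ {X Y : ∀ y : M', TangentSpace I' y} {y : M'}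
    (hX : MDiffAt (T% X) y) (hY : MDiffAt (T% Y) y) (h : ∀ᶠ z in 𝓝 y, X z = Y z) :
    cov X y = cov Y y :=
  cov.isCovariantDerivativeOn.congr_of_eventuallyEq hX hY Filter.univ_mem h

/-- The constant-component extension depends linearly on its value over the base set, and a
connection is local, so agreement of germs suffices. -/
lemma cov_extend_add {y : M'} (a b : TangentSpace I' y) :
    cov (FiberBundle.extend E' (a + b)) y =
      cov (FiberBundle.extend E' a) y + cov (FiberBundle.extend E' b) y := by
  have ha := FiberBundle.mdifferentiableAt_extend I' E' a
  have hb := FiberBundle.mdifferentiableAt_extend I' E' b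
  rw [← cov.isCovariantDerivativeOn.add ha hb]
  refine cov.congr_germ (FiberBundle.mdifferentiableAt_extend I' E' _)
    (mdifferentiableAt_add_section ha hb) ?_
  set t := trivializationAt E' (TangentSpace I' : M' → Type _) y
  have hy : y ∈ t.baseSet := FiberBundle.mem_baseSet_trivializationAt' y
  filter_upwards [t.open_baseSet.mem_nhds hy] with z hz
  simp only [FiberBundle.extend, Pi.add_apply]
  rw [← t.symmL_apply (R := ℝ) hz, ← t.symmL_apply (R := ℝ) hz, ← t.symmL_apply (R := ℝ) hz, ← map_add,
    ← t.continuousLinearMapAt_apply_of_mem ℝ hy, ← t.continuousLinearMapAt_apply_of_mem ℝ hy,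
    ← t.continuousLinearMapAt_apply_of_mem ℝ hy, map_add]

lemma cov_extend_smul {y : M'} (c : ℝ) (a : TangentSpace I' y) :
    cov (FiberBundle.extend E' (c • a)) y = c • cov (FiberBundle.extend E' a) y := by
  have ha := FiberBundle.mdifferentiableAt_extend I' E' a
  rw [← cov.isCovariantDerivativeOn.smul_const c ha]
  refine cov.congr_germ (FiberBundle.mdifferentiableAt_extend I' E' _) ha.smul_const_section ?_
  set t := trivializationAt E' (TangentSpace I' : M' → Type _) y
  have hy : y ∈ t.baseSet := FiberBundle.mem_baseSet_trivializationAt' y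
  filter_upwards [t.open_baseSet.mem_nhds hy] with z hz
  simp only [FiberBundle.extend, Pi.smul_apply]
  rw [← t.symmL_apply (R := ℝ) hz, ← t.symmL_apply (R := ℝ) hz, ← map_smul,
    ← t.continuousLinearMapAt_apply_of_mem ℝ hy, ← t.continuousLinearMapAt_apply_of_mem ℝ hy,
    map_smul]

end extend

section rules

variable {f : M → M'} {x : M} {N N₁ N₂ : ∀ x : M, TangentSpace I' (f x)}

omit [TopologicalSpace M] in
lemma alongComp_add (f : M → M') (N₁ N₂ : ∀ x : M, TangentSpace I' (f x)) (x : M) :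
    alongComp f (fun y ↦ N₁ y + N₂ y) x = alongComp f N₁ x + alongComp f N₂ x := by
  ext y
  simp only [alongComp, map_add, Pi.add_apply]

omit [TopologicalSpace M] in
lemma alongComp_smul (f : M → M') (h : M → ℝ) (N : ∀ x : M, TangentSpace I' (f x)) (x : M) :
    alongComp f (fun y ↦ h y • N y) x = h • alongComp f N x := by
  ext y
  simp only [alongComp, map_smul, Pi.smul_apply']

lemma MDiffAlongAt.add (h₁ : MDiffAlongAt I f N₁ x) (h₂ : MDiffAlongAt I f N₂ x) :
    MDiffAlongAt I f (fun y ↦ N₁ y + N₂ y) x := by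
  rw [mdiffAlongAt_iff] at *
  rw [alongComp_add]
  exact ⟨h₁.1, h₁.2.add h₂.2⟩

lemma MDiffAlongAt.smul {h : M → ℝ} (hh : MDiffAt h x) (hN : MDiffAlongAt I f N x) :
    MDiffAlongAt I f (fun y ↦ h y • N y) x := by
  rw [mdiffAlongAt_iff] at *
  rw [alongComp_smul]
  exact ⟨hN.1, hh.smul hN.2⟩

lemma mdiffAlongAt_comp {Y : ∀ y : M', TangentSpace I' y} (hf : MDifferentiableAt I I' f x)
    (hY : MDiffAt (T% Y) (f x)) : MDiffAlongAt I f (fun y ↦ Y (f y)) x :=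
  hY.comp x hf

variable [FiniteDimensional ℝ E'] (cov : CovariantDerivative I' E' (TangentSpace I' : M' → Type _))

omit [TopologicalSpace M] [FiniteDimensional ℝ E'] in
lemma symmL_alongComp (f : M → M') (N : ∀ x : M, TangentSpace I' (f x)) (x : M) :
    (trivializationAt E' (TangentSpace I' : M' → Type _) (f x)).symmL ℝ (f x)
      (alongComp f N x x) = N x :=
  Trivialization.symmL_continuousLinearMapAt _ (FiberBundle.mem_baseSet_trivializationAt' _) _

lemma covDerivAlong_add (h₁ : MDiffAlongAt I f N₁ x) (h₂ : MDiffAlongAt I f N₂ x)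
    (v : TangentSpace I x) :
    covDerivAlong cov f (fun y ↦ N₁ y + N₂ y) x v =
      covDerivAlong cov f N₁ x v + covDerivAlong cov f N₂ x v := by
  rw [mdiffAlongAt_iff] at *
  simp only [covDerivAlong_eq cov h₁.1.continuousAt]
  rw [alongComp_add, mvfderiv_add h₁.2 h₂.2, cov_extend_add, add_apply,
    add_apply, map_add]
  abel

lemma covDerivAlong_smul {h : M → ℝ} (hh : MDiffAt h x) (hN : MDiffAlongAt I f N x)
    (v : TangentSpace I x) :
    covDerivAlong cov f (fun y ↦ h y • N y) x v =
      h x • covDerivAlong cov f N x v + mvfderiv I h x v • N x := by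
  rw [mdiffAlongAt_iff] at *
  simp only [covDerivAlong_eq cov hN.1.continuousAt]
  rw [alongComp_smul, mvfderiv_smul hh hN.2, cov_extend_smul, add_apply,
    smul_apply, smul_apply,
    ContinuousLinearMap.smulRight_apply, map_add, map_smul, map_smul, symmL_alongComp]
  module

lemma covDerivAlong_congr (hf : ContinuousAt f x) (h : ∀ᶠ y in 𝓝 x, N₁ y = N₂ y)
    (v : TangentSpace I x) :
    covDerivAlong cov f N₁ x v = covDerivAlong cov f N₂ x v := by
  have h' : alongComp f N₁ x =ᶠ[𝓝 x] alongComp f N₂ x := by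
    filter_upwards [h] with y hy
    simp only [alongComp, hy]
  simp only [covDerivAlong_eq cov hf]
  rw [h.self_of_nhds, h'.mvfderiv_eq]

/-- Chain rule. Both sides obey the same Leibniz rule, so their difference is tensorial in `Y` and
may be tested on a field with constant components; there the derivative of the components vanishes
and only the `cov` term is left. -/
lemma covDerivAlong_comp {Y : ∀ y : M', TangentSpace I' y} (hf : MDifferentiableAt I I' f x)
    (hY : MDiffAt (T% Y) (f x)) (v : TangentSpace I x) :
    covDerivAlong cov f (fun y ↦ Y (f y)) x v = cov Y (f x) (mfderiv I I' f x v) := by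
  have key : TensorialAt I' E' (fun Y : (∀ y : M', TangentSpace I' y) ↦
      covDerivAlong cov f (fun y ↦ Y (f y)) x v - cov Y (f x) (mfderiv I I' f x v)) (f x) := by
    refine ⟨fun {h σ} hh hσ ↦ ?_, fun {σ σ'} hσ hσ' ↦ ?_⟩
    · have h1 := covDerivAlong_smul cov (h := h ∘ f) (hh.comp x hf) (mdiffAlongAt_comp hf hσ) v
      have h2 := congr($(cov.isCovariantDerivativeOn.leibniz hσ hh) (mfderiv I I' f x v))
      simp only [Function.comp_apply] at h1
      simp only [Pi.smul_apply', h1, h2, mvfderiv_comp_apply x hh hf, add_apply, smul_apply,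
        ContinuousLinearMap.smulRight_apply]
      module
    · have h1 := covDerivAlong_add cov (mdiffAlongAt_comp hf hσ) (mdiffAlongAt_comp hf hσ') v
      have h2 := congr($(cov.isCovariantDerivativeOn.add hσ hσ') (mfderiv I I' f x v))
      simp only [Pi.add_apply, h1, h2, add_apply]
      abel
  have h := key.pointwise hY (FiberBundle.mdifferentiableAt_extend I' E' (Y (f x)))
    (FiberBundle.extend_apply_self _ _).symm
  rw [← sub_eq_zero, h, covDerivAlong_eq cov hf.continuousAt, FiberBundle.extend_apply_self]
  have hc : alongComp f (fun y ↦ FiberBundle.extend E' (Y (f x)) (f y)) x =ᶠ[𝓝 x]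
      fun _ ↦ (trivializationAt E' (TangentSpace I' : M' → Type _) (f x) ⟨f x, Y (f x)⟩).2 := by
    filter_upwards [eventually_mem_baseSet (I' := I') hf.continuousAt] with y hy
    simp only [alongComp, FiberBundle.extend]
    rw [← Trivialization.symmL_apply (R := ℝ) _ hy,
      Trivialization.continuousLinearMapAt_symmL _ hy]
  have hd : mvfderiv I (alongComp f (fun y ↦ FiberBundle.extend E' (Y (f x)) (f y)) x) x = 0 := by
    rw [hc.mvfderiv_eq, mvfderiv_const]
  rw [hd]
  simp

/-- An operation on fields along `f` that is tensorial and local at `x`, and vanishes on the fields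
`Y ∘ f`, vanishes. -/
lemma alongTensorial_eq_zero {A : Type*} [AddCommGroup A] [Module ℝ A]
    {Φ : (∀ x : M, TangentSpace I' (f x)) → A} (hf : MDifferentiableAt I I' f x)
    (hadd : ∀ {N₁ N₂}, MDiffAlongAt I f N₁ x → MDiffAlongAt I f N₂ x →
      Φ (fun y ↦ N₁ y + N₂ y) = Φ N₁ + Φ N₂)
    (hsmul : ∀ {h : M → ℝ} {N}, MDiffAt h x → MDiffAlongAt I f N x →
      Φ (fun y ↦ h y • N y) = h x • Φ N)
    (hcongr : ∀ {N₁ N₂}, MDiffAlongAt I f N₁ x → MDiffAlongAt I f N₂ x →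
      (∀ᶠ y in 𝓝 x, N₁ y = N₂ y) → Φ N₁ = Φ N₂)
    (hcomp : ∀ {Y : ∀ y : M', TangentSpace I' y}, MDiffAt (T% Y) (f x) →
      Φ (fun y ↦ Y (f y)) = 0)
    (hN : MDiffAlongAt I f N x) : Φ N = 0 := by
  classical
  let t := trivializationAt E' (TangentSpace I' : M' → Type _) (f x)
  let b := Module.finBasis ℝ E'
  -- Expand `N` in the coordinate frame at `f x`: the frame fields live on `M'`, and the
  -- coefficients are functions on `M`.
  let e (i) : ∀ y : M', TangentSpace I' y := FiberBundle.extend E' (t.symm (f x) (b i))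
  let c (i) (y : M) : ℝ := b.coord i (alongComp f N x y)
  have he (i) : MDiffAt (T% (e i)) (f x) := FiberBundle.mdifferentiableAt_extend I' E' _
  have hc (i) : MDiffAt (c i) x :=
    (LinearMap.toContinuousLinearMap (b.coord i)).mdifferentiableAt.comp x
      (mdiffAlongAt_iff.1 hN).2
  have hsum (s : Finset (Fin (Module.finrank ℝ E'))) :
      MDiffAlongAt I f (fun y ↦ ∑ i ∈ s, c i y • e i (f y)) x ∧
        Φ (fun y ↦ ∑ i ∈ s, c i y • e i (f y)) = 0 := by
    induction s using Finset.induction_on with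
    | empty =>
      simp only [Finset.sum_empty]
      have h0 : MDiffAt (T% (0 : ∀ y : M', TangentSpace I' y)) (f x) :=
        mdifferentiableAt_zeroSection ℝ (TangentSpace I' : M' → Type _)
      exact ⟨mdiffAlongAt_comp hf h0, hcomp h0⟩
    | insert i s hi ih =>
      simp only [Finset.sum_insert hi]
      have h1 := MDiffAlongAt.smul (hc i) (mdiffAlongAt_comp hf (he i))
      refine ⟨h1.add ih.1, ?_⟩
      rw [hadd h1 ih.1, ih.2, hsmul (hc i) (mdiffAlongAt_comp hf (he i)), hcomp (he i)]
      simp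
  -- The expansion of `N` is valid only near `x`, which is where locality of `Φ` enters.
  rw [← (hsum Finset.univ).2]
  refine hcongr hN (hsum Finset.univ).1 ?_
  have hx : f x ∈ t.baseSet := FiberBundle.mem_baseSet_trivializationAt' _
  filter_upwards [eventually_mem_baseSet (I' := I') hf.continuousAt] with y hy
  have h1 : N y = t.symmL ℝ (f y) (alongComp f N x y) :=
    (t.symmL_continuousLinearMapAt hy _).symm
  have h2 (i) : e i (f y) = t.symmL ℝ (f y) (b i) := by
    simp only [e, FiberBundle.extend]
    rw [t.apply_mk_symm hx, t.symmL_apply (R := ℝ) hy]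
  simp only [h2, ← map_smul, ← map_sum]
  rw [h1]
  congr 1
  exact (b.sum_repr _).symm

end rules

end AlongMaps

/-! ### Compatibility with parallel endomorphisms and with the metric. -/

section ProductRules

variable {E : Type*} [NormedAddCommGroup E] [NormedSpace ℝ E]
  {H : Type*} [TopologicalSpace H] {I : ModelWithCorners ℝ E H}
  {M : Type*} [TopologicalSpace M] [ChartedSpace H M]
  {E' : Type*} [NormedAddCommGroup E'] [NormedSpace ℝ E'] [FiniteDimensional ℝ E']
  {H' : Type*} [TopologicalSpace H'] {I' : ModelWithCorners ℝ E' H'}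
  {M' : Type*} [TopologicalSpace M'] [ChartedSpace H' M'] [IsManifold I' ∞ M']
  {f : M → M'} {x : M} {N N₁ N₂ : ∀ x : M, TangentSpace I' (f x)}

omit [FiniteDimensional ℝ E'] in
lemma MDiffAlongAt.mdifferentiableAt (hN : MDiffAlongAt I f N x) : MDifferentiableAt I I' f x :=
  (mdiffAlongAt_iff.1 hN).1

lemma MDiffAlongAt.map_endo {J : ∀ y : M', TangentSpace I' y →L[ℝ] TangentSpace I' y}
    (hJ : IsSmoothEndo J) (hN : MDiffAlongAt I f N x) :
    MDiffAlongAt I f (fun y ↦ J (f y) (N y)) x := by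
  have h := (hJ.contMDiffAt (x := f x)).mdifferentiableAt (by simp)
  exact MDifferentiableAt.clm_bundle_apply (h.comp x hN.mdifferentiableAt) hN

omit [FiniteDimensional ℝ E'] in
lemma mdiffAlongAt_pushforward [IsManifold I ∞ M] (hf : ContMDiff I I' ∞ f)
    {Y : ∀ y : M, TangentSpace I y} (hY : MDiffAt (T% Y) x) :
    MDiffAlongAt I f (fun y ↦ mfderiv I I' f y (Y y)) x := by
  have h : ContMDiff I.tangent I'.tangent ∞ (tangentMap I I' f) :=
    hf.contMDiff_tangentMap (by simp)
  exact ((h.contMDiffAt (x := ⟨x, Y x⟩)).mdifferentiableAt (by simp)).comp x hY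

variable (cov : CovariantDerivative I' E' (TangentSpace I' : M' → Type _))

/-- The failure to commute is tensorial in `N`, hence determined by fields `Y ∘ f`, for which the
chain rule reduces it to `∇J = 0` on `M'`. -/
lemma covDerivAlong_endo {J : ∀ y : M', TangentSpace I' y →L[ℝ] TangentSpace I' y}
    (hJ : IsSmoothEndo J)
    (hpar : ∀ (y : M') (Y : ∀ y : M', TangentSpace I' y), MDiffAt (T% Y) y →
      ∀ v : TangentSpace I' y, covDerivEndo cov J Y y v = 0)
    (hN : MDiffAlongAt I f N x) (v : TangentSpace I x) :
    covDerivAlong cov f (fun y ↦ J (f y) (N y)) x v = J (f x) (covDerivAlong cov f N x v) := by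
  have hf := hN.mdifferentiableAt
  rw [← sub_eq_zero]
  refine alongTensorial_eq_zero
    (Φ := fun N ↦ covDerivAlong cov f (fun y ↦ J (f y) (N y)) x v
      - J (f x) (covDerivAlong cov f N x v)) hf ?_ ?_ ?_ ?_ hN
  · intro N₁ N₂ h₁ h₂
    simp only [map_add]
    rw [covDerivAlong_add cov (h₁.map_endo hJ) (h₂.map_endo hJ), covDerivAlong_add cov h₁ h₂,
      map_add]
    abel
  · intro h N hh hN
    simp only [map_smul]
    rw [covDerivAlong_smul cov hh (hN.map_endo hJ), covDerivAlong_smul cov hh hN,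
      map_add, map_smul, map_smul]
    module
  · intro N₁ N₂ h₁ h₂ h
    rw [covDerivAlong_congr cov hf.continuousAt h,
      covDerivAlong_congr cov hf.continuousAt (h.mono fun y hy ↦ congrArg (J (f y)) hy)]
  · intro Y hY
    have hJY : MDiffAt (T% (fun y ↦ J y (Y y))) (f x) :=
      MDifferentiableAt.clm_bundle_apply ((hJ.contMDiffAt (x := f x)).mdifferentiableAt (by simp)) hY
    rw [covDerivAlong_comp cov hf hY, covDerivAlong_comp (Y := fun y ↦ J y (Y y)) cov hf hJY]
    exact hpar (f x) Y hY _

variable [RiemannianBundle (fun y : M' ↦ TangentSpace I' y)]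
  [IsContMDiffRiemannianBundle I' ∞ E' (fun y : M' ↦ TangentSpace I' y)]

omit [FiniteDimensional ℝ E'] in
lemma MDiffAlongAt.inner (h₁ : MDiffAlongAt I f N₁ x) (h₂ : MDiffAlongAt I f N₂ x) :
    MDiffAt (fun y ↦ (inner ℝ (N₁ y) (N₂ y) : ℝ)) x :=
  MDifferentiableAt.inner_bundle (IB := I') (F := E')
    (E := fun y : M' ↦ TangentSpace I' y) (b := f) h₁ h₂

/-- Tensoriality is applied to one slot at a time. Here the second slot already comes from `M'`;
reducing the first leaves metric compatibility on `M'` composed with `f`. -/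
lemma mvfderiv_inner_along_comp {cov : CovariantDerivative I' E' (TangentSpace I' : M' → Type _)}
    (hcov : IsLeviCivita cov) {Z : ∀ y : M', TangentSpace I' y} (hZ : MDiffAt (T% Z) (f x))
    (hN : MDiffAlongAt I f N x) (v : TangentSpace I x) :
    mvfderiv I (fun y ↦ (inner ℝ (N y) (Z (f y)) : ℝ)) x v =
      inner ℝ (covDerivAlong cov f N x v) (Z (f x)) +
        inner ℝ (N x) (cov Z (f x) (mfderiv I I' f x v)) := by
  have hf := hN.mdifferentiableAt
  have hZf : MDiffAlongAt I f (fun y ↦ Z (f y)) x := mdiffAlongAt_comp hf hZ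
  rw [← sub_eq_zero]
  refine alongTensorial_eq_zero
    (Φ := fun N ↦ mvfderiv I (fun y ↦ (inner ℝ (N y) (Z (f y)) : ℝ)) x v -
      (inner ℝ (covDerivAlong cov f N x v) (Z (f x)) +
        inner ℝ (N x) (cov Z (f x) (mfderiv I I' f x v)))) hf ?_ ?_ ?_ ?_ hN
  · intro N₁ N₂ h₁ h₂
    simp only [inner_add_left]
    rw [mvfderiv_fun_add (h₁.inner hZf) (h₂.inner hZf), covDerivAlong_add cov h₁ h₂,
      inner_add_left, add_apply]
    ring
  · intro h N hh hN
    simp only [real_inner_smul_left]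
    rw [mvfderiv_fun_mul hh (hN.inner hZf), covDerivAlong_smul cov hh hN,
      inner_add_left, real_inner_smul_left, real_inner_smul_left, add_apply, smul_apply, smul_apply,
      smul_eq_mul, smul_eq_mul, smul_eq_mul]
    ring
  · intro N₁ N₂ h₁ h₂ h
    have h' : (fun y ↦ (inner ℝ (N₁ y) (Z (f y)) : ℝ)) =ᶠ[𝓝 x]
        fun y ↦ (inner ℝ (N₂ y) (Z (f y)) : ℝ) := by
      filter_upwards [h] with y hy
      rw [hy]
    rw [covDerivAlong_congr cov hf.continuousAt h, h.self_of_nhds, h'.mvfderiv_eq]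
  · intro Y hY
    have h1 := hcov.metric (f x) Y Z hY hZ (mfderiv I I' f x v)
    have hd : MDiffAt (fun y ↦ (inner ℝ (Y y) (Z y) : ℝ)) (f x) :=
      MDifferentiableAt.inner_bundle (IB := I') (F := E')
        (E := fun y : M' ↦ TangentSpace I' y) (b := id) hY hZ
    have h2 := mvfderiv_comp_apply x hd hf v
    rw [covDerivAlong_comp cov hf hY, ← h1, sub_eq_zero]
    exact h2

/-- The connection along `f` induced by a metric connection is metric. -/
lemma mvfderiv_inner_along {cov : CovariantDerivative I' E' (TangentSpace I' : M' → Type _)}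
    (hcov : IsLeviCivita cov) (h₁ : MDiffAlongAt I f N₁ x) (h₂ : MDiffAlongAt I f N₂ x)
    (v : TangentSpace I x) :
    mvfderiv I (fun y ↦ (inner ℝ (N₁ y) (N₂ y) : ℝ)) x v =
      inner ℝ (covDerivAlong cov f N₁ x v) (N₂ x) +
        inner ℝ (N₁ x) (covDerivAlong cov f N₂ x v) := by
  have hf := h₁.mdifferentiableAt
  rw [← sub_eq_zero]
  refine alongTensorial_eq_zero
    (Φ := fun N ↦ mvfderiv I (fun y ↦ (inner ℝ (N₁ y) (N y) : ℝ)) x v -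
      (inner ℝ (covDerivAlong cov f N₁ x v) (N x) +
        inner ℝ (N₁ x) (covDerivAlong cov f N x v))) hf ?_ ?_ ?_ ?_ h₂
  · intro N N' h h'
    simp only [inner_add_right]
    rw [mvfderiv_fun_add (h₁.inner h) (h₁.inner h'), covDerivAlong_add cov h h',
      inner_add_right, add_apply]
    ring
  · intro h N hh hN
    simp only [real_inner_smul_right]
    rw [mvfderiv_fun_mul hh (h₁.inner hN), covDerivAlong_smul cov hh hN,
      inner_add_right, real_inner_smul_right, real_inner_smul_right, add_apply, smul_apply,
      smul_apply, smul_eq_mul, smul_eq_mul, smul_eq_mul]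
    ring
  · intro N N' h h' hNN'
    have hi : (fun y ↦ (inner ℝ (N₁ y) (N y) : ℝ)) =ᶠ[𝓝 x]
        fun y ↦ (inner ℝ (N₁ y) (N' y) : ℝ) := by
      filter_upwards [hNN'] with y hy
      rw [hy]
    rw [covDerivAlong_congr cov hf.continuousAt hNN', hNN'.self_of_nhds, hi.mvfderiv_eq]
  · intro Z hZ
    rw [covDerivAlong_comp cov hf hZ, mvfderiv_inner_along_comp hcov hZ h₁, sub_self]

end ProductRules

/-! ### Coordinate fields and vanishing torsion along a map. -/

section Torsion

variable {E : Type*} [NormedAddCommGroup E] [NormedSpace ℝ E] [FiniteDimensional ℝ E]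
  {H : Type*} [TopologicalSpace H] {I : ModelWithCorners ℝ E H}
  {M : Type*} [TopologicalSpace M] [ChartedSpace H M] [IsManifold I ∞ M]

omit [FiniteDimensional ℝ E] in
-- The tangent bundle is trivialized by the derivative of the chart, so constant components mean a
-- constant vector pushed forward by the inverse chart.
lemma extend_eq_mfderivWithin_extChartAt_symm {x y : M} (hy : y ∈ (chartAt H x).source)
    (w : TangentSpace I x) :
    FiberBundle.extend E w y =
      mfderivWithin 𝓘(ℝ, E) I (extChartAt I x).symm (Set.range I) (extChartAt I x y)
        (mvfderiv I (extChartAt I x) x w) := by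
  have hx : x ∈ (chartAt H x).source := mem_chart_source H x
  have h1 := congr($(TangentBundle.continuousLinearMapAt_trivializationAt (𝕜 := ℝ) (I := I) hx) w)
  have h2 := congr($(TangentBundle.symmL_trivializationAt (𝕜 := ℝ) (I := I) hy)
    (mvfderiv I (extChartAt I x) x w))
  rw [← h2, Trivialization.symmL_apply (R := ℝ) _ hy]
  unfold FiberBundle.extend
  rw [← Trivialization.continuousLinearMapAt_apply_of_mem ℝ _ hx]
  exact congrArg _ h1

omit [FiniteDimensional ℝ E] in
/-- Coordinate fields commute. -/
lemma mlieBracket_extend [CompleteSpace E] {x : M} (a b : TangentSpace I x) :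
    VectorField.mlieBracket I (FiberBundle.extend E a) (FiberBundle.extend E b) x = 0 := by
  -- Read in the chart, the extensions are constant vector fields, whose bracket is zero.
  have h (w : TangentSpace I x) :
      VectorField.mpullbackWithin 𝓘(ℝ, E) I (extChartAt I x).symm (FiberBundle.extend E w)
        (Set.range I) =ᶠ[𝓝[Set.range I] (extChartAt I x x)]
        fun _ ↦ mvfderiv I (extChartAt I x) x w := by
    filter_upwards [extChartAt_target_mem_nhdsWithin (I := I) x] with z hz
    have hy : (extChartAt I x).symm z ∈ (chartAt H x).source := by
      rw [← extChartAt_source I]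
      exact (extChartAt I x).map_target hz
    rw [VectorField.mpullbackWithin_apply, extend_eq_mfderivWithin_extChartAt_symm hy,
      (extChartAt I x).right_inv hz]
    exact ContinuousLinearMap.IsInvertible.inverse_apply_eq
      (isInvertible_mfderivWithin_extChartAt_symm hz) |>.2 rfl
  rw [← VectorField.mlieBracketWithin_univ, VectorField.mlieBracketWithin_apply, Set.preimage_univ,
    Set.univ_inter]
  have h0 := Filter.EventuallyEq.lieBracketWithin_vectorField_eq (𝕜 := ℝ) (h a)
    ((h a).self_of_nhdsWithin (Set.mem_range_self _)) (h b)
    ((h b).self_of_nhdsWithin (Set.mem_range_self _))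
  refine (congrArg _ (h0.trans ?_)).trans (map_zero _)
  simp [VectorField.lieBracketWithin]
  rfl

lemma IsLeviCivita.cov_extend_comm [RiemannianBundle (fun x : M ↦ TangentSpace I x)]
    {cov : CovariantDerivative I E (TangentSpace I : M → Type _)}
    (hcov : IsLeviCivita cov) {x : M} (a b : TangentSpace I x) :
    cov (FiberBundle.extend E b) x a = cov (FiberBundle.extend E a) x b := by
  have h := cov.torsion_apply_eq_extend a b
  rw [hcov.torsion_free, mlieBracket_extend] at h
  simp only [Pi.zero_apply, zero_apply, FiberBundle.extend_apply_self,
    sub_zero] at h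
  exact sub_eq_zero.1 h.symm

variable [I.Boundaryless]
  {E' : Type*} [NormedAddCommGroup E'] [NormedSpace ℝ E'] [FiniteDimensional ℝ E']
  {H' : Type*} [TopologicalSpace H'] {I' : ModelWithCorners ℝ E' H'}
  {M' : Type*} [TopologicalSpace M'] [ChartedSpace H' M'] [IsManifold I' ∞ M']

omit [FiniteDimensional ℝ E] [FiniteDimensional ℝ E'] in
/-- The components of the push-forward of a coordinate field, as derivatives of `f` read in
charts. -/
lemma alongComp_pushforward_extend {f : M → M'} (hf : ContMDiff I I' ∞ f) {x : M}
    (w : TangentSpace I x) :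
    alongComp f (fun y ↦ mfderiv I I' f y (FiberBundle.extend E w y)) x =ᶠ[𝓝 x]
      fun y ↦ fderiv ℝ (extChartAt I' (f x) ∘ f ∘ (extChartAt I x).symm) (extChartAt I x y)
        (mvfderiv I (extChartAt I x) x w) := by
  filter_upwards [eventually_mem_baseSet (I' := I') hf.continuous.continuousAt,
    (chartAt H x).open_source.mem_nhds (mem_chart_source H x)] with y hfy hy
  have hfy' : f y ∈ (chartAt H' (f x)).source := hfy
  have hz : extChartAt I x y ∈ (extChartAt I x).target :=
    (extChartAt I x).map_source (by rwa [extChartAt_source])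
  have hinv : (extChartAt I x).symm (extChartAt I x y) = y :=
    (extChartAt I x).left_inv (by rwa [extChartAt_source])
  have hd1 : MDifferentiableAt 𝓘(ℝ, E) I (extChartAt I x).symm (extChartAt I x y) := by
    have := mdifferentiableWithinAt_extChartAt_symm (I := I) hz
    rwa [I.range_eq_univ, mdifferentiableWithinAt_univ] at this
  have hd2 : MDifferentiableAt I I' f y := hf.contMDiffAt.mdifferentiableAt (by simp)
  have hd3 : MDifferentiableAt I' 𝓘(ℝ, E') (extChartAt I' (f x)) (f y) :=
    mdifferentiableAt_extChartAt hfy'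
  unfold alongComp
  beta_reduce
  rw [extend_eq_mfderivWithin_extChartAt_symm hy, I.range_eq_univ, mfderivWithin_univ]
  have h1 := fun u ↦ congr($(TangentBundle.continuousLinearMapAt_trivializationAt (𝕜 := ℝ)
    (I := I') hfy') u)
  refine (h1 _).trans ?_
  have h2 := mfderiv_comp_apply_of_eq (extChartAt I x y) (hd3.comp y hd2) hd1 hinv
    (mvfderiv I (extChartAt I x) x w)
  rw [mfderiv_comp y hd3 hd2] at h2
  refine h2.symm.trans ?_
  rw [← mfderiv_eq_fderiv]
  rfl

omit [FiniteDimensional ℝ E] [FiniteDimensional ℝ E'] in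
-- Both sides are second derivatives of `f` read in charts, so this is the symmetry of the second
-- derivative.
lemma mvfderiv_alongComp_pushforward_extend_comm {f : M → M'} (hf : ContMDiff I I' ∞ f) {x : M}
    (a b : TangentSpace I x) :
    mvfderiv I (alongComp f (fun y ↦ mfderiv I I' f y (FiberBundle.extend E b y)) x) x a =
      mvfderiv I (alongComp f (fun y ↦ mfderiv I I' f y (FiberBundle.extend E a y)) x) x b := by
  set F := extChartAt I' (f x) ∘ f ∘ (extChartAt I x).symm with hF
  have hFs : ContDiffAt ℝ ∞ F (extChartAt I x x) := by
    have := (contMDiffAt_iff.1 (hf.contMDiffAt (x := x))).2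
    rwa [I.range_eq_univ, contDiffWithinAt_univ] at this
  have hsymm : IsSymmSndFDerivAt ℝ F (extChartAt I x x) :=
    hFs.isSymmSndFDerivAt (by simp; norm_cast)
  have hd : DifferentiableAt ℝ (fderiv ℝ F) (extChartAt I x x) :=
    (hFs.fderiv_right (m := 1) (by norm_cast)).differentiableAt (by simp)
  have key (v w : TangentSpace I x) :
      mvfderiv I (alongComp f (fun y ↦ mfderiv I I' f y (FiberBundle.extend E w y)) x) x v =
        fderiv ℝ (fderiv ℝ F) (extChartAt I x x) (mvfderiv I (extChartAt I x) x v)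
          (mvfderiv I (extChartAt I x) x w) := by
    rw [(alongComp_pushforward_extend hf w).mvfderiv_eq]
    have hg : HasFDerivAt (fun z ↦ fderiv ℝ F z (mvfderiv I (extChartAt I x) x w))
        ((fderiv ℝ (fderiv ℝ F) (extChartAt I x x)).flip (mvfderiv I (extChartAt I x) x w))
        (extChartAt I x x) := by
      simpa using hd.hasFDerivAt.clm_apply (hasFDerivAt_const _ _)
    have h := mfderiv_comp_apply x hg.differentiableAt.mdifferentiableAt
      (mdifferentiableAt_extChartAt (mem_chart_source H x)) v
    refine h.trans ?_
    rw [mfderiv_eq_fderiv, hg.fderiv]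
    rfl
  rw [key, key, hsymm.eq]

omit [FiniteDimensional ℝ E] in
/-- The connection along `f` is torsion-free. -/
lemma covDerivAlong_pushforward_extend_comm [RiemannianBundle (fun y : M' ↦ TangentSpace I' y)]
    {cov : CovariantDerivative I' E' (TangentSpace I' : M' → Type _)} (hcov : IsLeviCivita cov)
    {f : M → M'} (hf : ContMDiff I I' ∞ f) {x : M} (a b : TangentSpace I x) :
    covDerivAlong cov f (fun y ↦ mfderiv I I' f y (FiberBundle.extend E b y)) x a =
      covDerivAlong cov f (fun y ↦ mfderiv I I' f y (FiberBundle.extend E a y)) x b := by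
  simp only [covDerivAlong_eq cov hf.continuous.continuousAt]
  rw [mvfderiv_alongComp_pushforward_extend_comm hf, FiberBundle.extend_apply_self,
    FiberBundle.extend_apply_self, hcov.cov_extend_comm]

end Torsion

/-! ### The Gauss formula and the shape operator. -/

section Hypersurfaces

variable {E : Type*} [NormedAddCommGroup E] [NormedSpace ℝ E] [FiniteDimensional ℝ E]
  {H : Type*} [TopologicalSpace H] {I : ModelWithCorners ℝ E H}
  {M : Type*} [TopologicalSpace M] [ChartedSpace H M] [IsManifold I ∞ M] [I.Boundaryless]
  [RiemannianBundle (fun x : M ↦ TangentSpace I x)]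
  {E' : Type*} [NormedAddCommGroup E'] [NormedSpace ℝ E'] [FiniteDimensional ℝ E']
  {H' : Type*} [TopologicalSpace H'] {I' : ModelWithCorners ℝ E' H'}
  {M' : Type*} [TopologicalSpace M'] [ChartedSpace H' M'] [IsManifold I' ∞ M']
  [RiemannianBundle (fun y : M' ↦ TangentSpace I' y)]
  [IsContMDiffRiemannianBundle I' ∞ E' (fun y : M' ↦ TangentSpace I' y)]
  {cov : CovariantDerivative I E (TangentSpace I : M → Type _)}
  {cov' : CovariantDerivative I' E' (TangentSpace I' : M' → Type _)}
  {f : M → M'} {ν : ∀ x : M, TangentSpace I' (f x)} {x : M}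

/-- The Gauss formula: the tangential part of `∇'_v (df Y)` is `df (∇_v Y)`. -/
lemma inner_covDerivAlong_pushforward (hcov : IsLeviCivita cov) (hcov' : IsLeviCivita cov')
    (hf : ContMDiff I I' ∞ f)
    (hiso : ∀ (x : M) (v w : TangentSpace I x),
      inner ℝ (mfderiv I I' f x v) (mfderiv I I' f x w) = (inner ℝ v w : ℝ))
    {Y : ∀ y : M, TangentSpace I y} (hY : MDiffAt (T% Y) x) (v z : TangentSpace I x) :
    (inner ℝ (covDerivAlong cov' f (fun y ↦ mfderiv I I' f y (Y y)) x v)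
      (mfderiv I I' f x z) : ℝ) = inner ℝ (cov Y x v) z := by
  -- `B` is the defect in the Gauss formula. It is tensorial in `Y`, so coordinate fields suffice;
  -- it is symmetric in its first two arguments because both connections are torsion-free, and skew
  -- in the last two because both are metric.
  let B (v : TangentSpace I x) (Y : ∀ y : M, TangentSpace I y) (z : TangentSpace I x) : ℝ :=
    inner ℝ (covDerivAlong cov' f (fun y ↦ mfderiv I I' f y (Y y)) x v) (mfderiv I I' f x z) -
      inner ℝ (cov Y x v) z
  have hB : TensorialAt I E (fun Y ↦ B v Y z) x := by
    refine ⟨fun {h σ} hh hσ ↦ ?_, fun {σ σ'} hσ hσ' ↦ ?_⟩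
    · have h1 := covDerivAlong_smul cov' hh (mdiffAlongAt_pushforward hf hσ) v
      simp only [B, Pi.smul_apply', map_smul, h1, cov.isCovariantDerivativeOn.leibniz hσ hh,
        add_apply, smul_apply, ContinuousLinearMap.smulRight_apply, inner_add_left,
        real_inner_smul_left, hiso, smul_eq_mul]
      ring
    · have h1 := covDerivAlong_add cov' (mdiffAlongAt_pushforward hf hσ)
        (mdiffAlongAt_pushforward hf hσ') v
      simp only [B, Pi.add_apply, map_add, h1, cov.isCovariantDerivativeOn.add hσ hσ',
        add_apply, inner_add_left]
      ring
  have he (w : TangentSpace I x) : MDiffAt (T% (FiberBundle.extend E w)) x :=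
    FiberBundle.mdifferentiableAt_extend I E w
  have hsymm (v w z : TangentSpace I x) :
      B v (FiberBundle.extend E w) z = B w (FiberBundle.extend E v) z := by
    simp only [B]
    rw [covDerivAlong_pushforward_extend_comm hcov' hf, hcov.cov_extend_comm]
  have hskew (v w z : TangentSpace I x) :
      B v (FiberBundle.extend E w) z = -B v (FiberBundle.extend E z) w := by
    have h1 := mvfderiv_inner_along hcov' (mdiffAlongAt_pushforward hf (he w))
      (mdiffAlongAt_pushforward hf (he z)) v
    have h2 := hcov.metric x _ _ (he w) (he z) v
    simp only [hiso, h2, FiberBundle.extend_apply_self] at h1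
    simp only [B]
    rw [real_inner_comm _ (mfderiv I I' f x w), real_inner_comm _ w] at h1
    linarith
  -- Alternating the two symmetries returns to the same term after three sign changes, so `B = -B`.
  have hzero (w : TangentSpace I x) : B v (FiberBundle.extend E w) z = 0 := by
    linarith [hskew v w z, hsymm v z w, hskew z v w, hsymm z w v, hskew w z v, hsymm w v z]
  have h := hB.pointwise hY (he (Y x)) (FiberBundle.extend_apply_self _ _).symm
  exact sub_eq_zero.1 (h.trans (hzero (Y x)))

omit [IsManifold I ∞ M] [I.Boundaryless]
  [IsContMDiffRiemannianBundle I' ∞ E' (fun y : M' ↦ TangentSpace I' y)] in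
lemma inner_shapeOperator (cov' : CovariantDerivative I' E' (TangentSpace I' : M' → Type _))
    (f : M → M') (ν : ∀ x : M, TangentSpace I' (f x)) (x : M) (v z : TangentSpace I x) :
    (inner ℝ (shapeOperator cov' f ν x v) z : ℝ) =
      -inner ℝ (covDerivAlong cov' f ν x v) (mfderiv I I' f x z) := by
  have : FiniteDimensional ℝ (TangentSpace I x) := inferInstanceAs (FiniteDimensional ℝ E)
  have : FiniteDimensional ℝ (TangentSpace I' (f x)) := inferInstanceAs (FiniteDimensional ℝ E')
  unfold shapeOperator
  rw [LinearMap.adjoint_inner_left, inner_neg_left]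
  rfl

variable {p q : ℕ} {J : ∀ y : M', TangentSpace I' y →L[ℝ] TangentSpace I' y}
  {φ : ∀ x : M, TangentSpace I x →L[ℝ] TangentSpace I x}
  {ξ : ∀ x : M, TangentSpace I x} {η : ∀ x : M, TangentSpace I x →L[ℝ] ℝ} {β : M → ℝ}

omit [I.Boundaryless] [FiniteDimensional ℝ E] [FiniteDimensional ℝ E']
  [IsContMDiffRiemannianBundle I' ∞ E' (fun y : M' ↦ TangentSpace I' y)] in
-- Since `φ ξ = 0`, the decomposition of `J (df ξ)` reads `ν = η(ξ) ν`; pair it with the unit vector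
-- `ν`.
lemma IsQuadraticMetricHypersurface.form_apply_field
    (hM : IsQuadraticMetricHypersurface p q J f ν φ ξ η) (x : M) : η x (ξ x) = 1 := by
  have h := hM.map_tangent x (ξ x)
  rw [hM.map_field, hM.almostQuadratic.apply_field, map_zero, zero_add] at h
  have h' := congrArg (fun u ↦ (inner ℝ u (ν x) : ℝ)) h
  simp only [real_inner_smul_left, hM.immersion.unit, mul_one] at h'
  exact h'.symm

omit [I.Boundaryless] [FiniteDimensional ℝ E] [FiniteDimensional ℝ E']
  [IsContMDiffRiemannianBundle I' ∞ E' (fun y : M' ↦ TangentSpace I' y)] in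
/-- The metallic coefficient `q` of the ambient manifold is `1` as soon as `J ξ = ν`, by the
compatibility of `J` with the metric. -/
lemma IsQuadraticMetricHypersurface.coeff_eq_one
    (hJ : ∀ (y : M') (v w : TangentSpace I' y), (inner ℝ (J y v) w : ℝ) = inner ℝ v (J y w))
    (hM : IsQuadraticMetricHypersurface p q J f ν φ ξ η) (x : M) : (q : ℝ) = 1 := by
  have h := hJ (f x) (mfderiv I I' f x (ξ x)) (ν x)
  rw [hM.map_field, hM.map_normal, inner_add_right, real_inner_smul_right, real_inner_smul_right,
    hM.immersion.unit, hM.immersion.normal, hM.immersion.isometric, hM.almostQuadratic.unit] at h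
  linarith

/-- The shape operator of a `(β, φ)`-Kenmotsu hypersurface is `β φ`. -/
lemma IsKenmotsu.shapeOperator_eq (hJ : IsLocallyMetallic cov' p q J)
    (hM : IsQuadraticMetricHypersurface p q J f ν φ ξ η) (hK : IsKenmotsu cov β φ ξ η)
    (x : M) (v : TangentSpace I x) : shapeOperator cov' f ν x v = β x • φ x v := by
  have hf := hM.immersion.smooth
  have hξ : MDiffAt (T% ξ) x :=
    (hM.almostQuadratic.smooth_field.contMDiffAt (x := x)).mdifferentiableAt (by simp)
  have hν : MDiffAlongAt I f ν x :=
    (hM.immersion.smooth_normal.contMDiffAt (x := x)).mdifferentiableAt (by simp)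
  have hdξ : MDiffAlongAt I f (fun y ↦ mfderiv I I' f y (ξ y)) x := mdiffAlongAt_pushforward hf hξ
  set W := covDerivAlong cov' f (fun y ↦ mfderiv I I' f y (ξ y)) x v with hW
  have hDν : covDerivAlong cov' f ν x v = J (f x) W := by
    rw [hW, ← covDerivAlong_endo cov' hJ.smooth hJ.parallel hdξ]
    congr 1
    funext y
    exact (hM.map_field y).symm
  -- Kenmotsu condition at `Y = ξ`: since `φ ξ` vanishes identically, only `-φ (∇_v ξ)` remains on
  -- the left.
  have hφξ : φ x (cov ξ x v) = -(β x • φ x v) := by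
    have h := hK.deriv_endo x ξ hξ v
    have h0 : (fun y ↦ φ y (ξ y)) = 0 := funext hM.almostQuadratic.apply_field
    rw [covDerivEndo, h0, cov.isCovariantDerivativeOn.zero, hM.almostQuadratic.apply_field,
      inner_zero_right, zero_smul, zero_add, hM.form_apply_field, one_smul, zero_apply,
      zero_sub] at h
    rw [← h, neg_neg]
  have hDν_inner (z : TangentSpace I x) :
      (inner ℝ (covDerivAlong cov' f ν x v) (mfderiv I I' f x z) : ℝ) =
        -(β x * inner ℝ (φ x v) z) + η x z * inner ℝ W (ν x) := by
    rw [hDν, hJ.compatible, hM.map_tangent, inner_add_right, real_inner_smul_right, hW,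
      inner_covDerivAlong_pushforward hK.leviCivita hJ.leviCivita hf hM.immersion.isometric hξ,
      ← hM.almostQuadratic.compatible, hφξ, inner_neg_left, real_inner_smul_left]
  -- `h1` makes the two pairings opposite, while `h2`, the case `z = ξ`, makes them equal.
  have hWν : (inner ℝ W (ν x) : ℝ) = 0 := by
    have h1 := mvfderiv_inner_along hJ.leviCivita hdξ hν v
    have h2 := hDν_inner (ξ x)
    simp only [hM.immersion.normal, mvfderiv_const, zero_apply] at h1
    rw [hM.form_apply_field, hM.almostQuadratic.compatible, hM.almostQuadratic.apply_field,
      inner_zero_right, mul_zero, neg_zero, zero_add, one_mul, real_inner_comm] at h2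
    linarith
  refine ext_inner_right ℝ fun z ↦ ?_
  rw [inner_shapeOperator, hDν_inner, hWν, real_inner_smul_left]
  ring

end Hypersurfaces

theorem mainTheorem8 {n : ℕ}
    {M : Type*} [TopologicalSpace M] [ChartedSpace (EuclideanSpace ℝ (Fin n)) M]
    [IsManifold (𝓡 n) ∞ M]
    [RiemannianBundle (fun x : M ↦ TangentSpace (𝓡 n) x)]
    [IsContMDiffRiemannianBundle (𝓡 n) ∞ (EuclideanSpace ℝ (Fin n))
      (fun x : M ↦ TangentSpace (𝓡 n) x)]
    {M' : Type*} [TopologicalSpace M'] [ChartedSpace (EuclideanSpace ℝ (Fin (n + 1))) M']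
    [IsManifold (𝓡 (n + 1)) ∞ M']
    [RiemannianBundle (fun y : M' ↦ TangentSpace (𝓡 (n + 1)) y)]
    [IsContMDiffRiemannianBundle (𝓡 (n + 1)) ∞ (EuclideanSpace ℝ (Fin (n + 1)))
      (fun y : M' ↦ TangentSpace (𝓡 (n + 1)) y)]
    -- the locally metallic Riemannian manifold
    (p q : ℕ)
    (cov' : CovariantDerivative (𝓡 (n + 1)) (EuclideanSpace ℝ (Fin (n + 1)))
      (TangentSpace (𝓡 (n + 1)) : M' → Type _))
    (J : ∀ y : M', TangentSpace (𝓡 (n + 1)) y →L[ℝ] TangentSpace (𝓡 (n + 1)) y)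
    (hJ : IsLocallyMetallic cov' p q J)
    -- the hypersurface with its induced structure
    (f : M → M') (ν : ∀ x : M, TangentSpace (𝓡 (n + 1)) (f x))
    (φ : ∀ x : M, TangentSpace (𝓡 n) x →L[ℝ] TangentSpace (𝓡 n) x)
    (ξ : ∀ x : M, TangentSpace (𝓡 n) x) (η : ∀ x : M, TangentSpace (𝓡 n) x →L[ℝ] ℝ)
    (hM : IsQuadraticMetricHypersurface p q J f ν φ ξ η)
    (cov : CovariantDerivative (𝓡 n) (EuclideanSpace ℝ (Fin n))
      (TangentSpace (𝓡 n) : M → Type _))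
    (β : M → ℝ) (hK : IsKenmotsu cov β φ ξ η) :
    (∀ (x : M) (v : TangentSpace (𝓡 n) x),
      φ x (shapeOperator cov' f ν x v) = shapeOperator cov' f ν x (φ x v)) ∧
    (∀ (x : M) (v : TangentSpace (𝓡 n) x), shapeOperator cov' f ν x v = β x • φ x v) ∧
    (∀ (x : M) (v : TangentSpace (𝓡 n) x),
      shapeOperator cov' f ν x (shapeOperator cov' f ν x v) =
        (β x * (p : ℝ)) • shapeOperator cov' f ν x v + β x ^ 2 • (v - η x v • ξ x)) := by
  have hA := fun x v ↦ hK.shapeOperator_eq hJ hM x v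
  refine ⟨fun x v ↦ ?_, hA, fun x v ↦ ?_⟩
  · rw [hA, hA, map_smul]
  -- The factor `q` coming from `φ²` disappears because `q = 1`.
  · rw [hA, hA, map_smul, hM.almostQuadratic.sq, hM.coeff_eq_one hJ.compatible x]
    module
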